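/- Let $R$ be a commutative principal ideal domain and $p\in R$ a nonzero generator of a maximal ideal such that the residue field $R/(p)$ is finite, with $q$ elements. A $p$-module is an $R$-module of finite length annihilated by some power of $p$. Let $\mathcal S$ be the category whose objects are the embeddings $(A\subset B)$ of $p$-modules and whose morphisms $(A\subset B)\to(A'\subset B')$ are the commutative squares, i.e. the $R$-linear maps $f:B\to B'$ with $f(A)\subseteq A'$. Put $P^m=R/(p^m)$. For $0\le \ell\le m$ let $P_\ell^m=\big((p^{m-\ell})\subset P^m\big)$ (a picket, when $m\ge 1$), and for $1\le r\le m-2$ let the bipicket $T_2^{m,r}$ be the embedding of the cyclic submodule generated by $(p^{m-2},p^{r-1})$ into $P^m\oplus P^r$. Then the following hold. 1. For $1\le r\le m-2$: $\#\mathrm{End}_{\mathcal S}T_2^{m,r}=q^{m+3r-1}$ and $\#\mathrm{Aut}_{\mathcal S}T_2^{m,r}=(1-\frac1q)\,q^{m+3r-1}$. 2. For $0\le u\le v$ and $0\le \ell\le m$: $\#\mathrm{Hom}_{\mathcal S}(P_u^v,P_\ell^m)=q^{\min\{m,\;v-\max\{0,u-\ell\}\}}$. For $0\le\ell\le m$ with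 $m\ge1$: $\#\mathrm{Aut}_{\mathcal S}P_\ell^m=(1-\frac1q)\,q^m$. 3. For $1\le w\le v-2$ and $0\le\ell\le m$: $$\#\mathrm{Hom}_{\mathcal S}(T_2^{v,w},P_\ell^m)=\begin{cases} q^{\min\{v-1,m\}+\min\{w-1,m\}}, & \ell=0,\\ q^{\min\{v-1,m\}+\min\{w,m\}}, & \ell=1,\\ q^{\min\{v,m\}+\min\{w,m\}}, & \ell\ge2.\end{cases}$$ 4. For $0\le u\le v$ and $1\le r\le m-2$: $$\#\mathrm{Hom}_{\mathcal S}(P_u^v,T_2^{m,r})=\begin{cases} q^{\min\{v,r\}+\min\{v,m\}}, & u=0,\\ q^{\min\{v-1,r\}+\min\{v,m\}}, & u=1,\\ q^{\min\{v-u+1,r\}+\min\{v-u+1,m\}}, & u\ge2.\end{cases}$$ -/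

import Mathlib

open CategoryTheory

universe u

/-- An embedding `(A ⊂ B)` of `p`-modules over `R`: a finite length `R`-module `B` which is
annihilated by some power of `p`, together with a submodule `A` of `B`. -/
structure PEmbedding (R : Type u) [CommRing R] (p : R) where
  /-- the ambient `p`-module `B` -/
  carrier : Type u
  [addCommGroup : AddCommGroup carrier]
  [module : Module R carrier]
  /-- the submodule `A` of `B` -/
  sub : Submodule R carrier
  isFiniteLength : IsFiniteLength R carrier
  exists_pow_smul_eq_zero : ∃ n : ℕ, ∀ b : carrier, p ^ n • b = 0

namespace PEmbedding

attribute [instance] PEmbedding.addCommGroup PEmbedding.module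

section Category

variable {R : Type u} [CommRing R] {p : R}

/-- A morphism `(A ⊂ B) ⟶ (A' ⊂ B')` is a commutative square, that is, an `R`-linear map
`f : B → B'` with `f(A) ⊆ A'`; the map `A → A'` is the restriction of `f`. -/
@[ext]
structure Hom (X Y : PEmbedding R p) where
  /-- the underlying linear map `B → B'` -/
  toLinearMap : X.carrier →ₗ[R] Y.carrier
  map_le : X.sub.map toLinearMap ≤ Y.sub

/-- The category `𝒮` of embeddings of `p`-modules. -/
instance : Category (PEmbedding R p) where
  Hom X Y := Hom X Y
  id X := ⟨LinearMap.id, by simp⟩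
  comp f g := ⟨g.toLinearMap ∘ₗ f.toLinearMap, by
    rw [Submodule.map_comp]
    exact (Submodule.map_mono f.map_le).trans g.map_le⟩

end Category

section Cyclic

variable {R : Type u} [CommRing R]

/-- The cyclic `p`-module `P^m = R/(p^m)`. -/
abbrev cyclic (p : R) (m : ℕ) : Type u := R ⧸ Ideal.span {p ^ m}

theorem pow_smul_cyclic (p : R) {m n : ℕ} (h : m ≤ n) (x : cyclic p m) : p ^ n • x = 0 := by
  obtain ⟨x, rfl⟩ := Ideal.Quotient.mk_surjective x
  rw [Algebra.smul_def, Ideal.Quotient.algebraMap_eq, ← map_mul, Ideal.Quotient.eq_zero_iff_mem]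
  exact Ideal.mul_mem_right _ _ (Ideal.mem_span_singleton.2 (pow_dvd_pow p h))

end Cyclic

section Objects

variable {R : Type u} [CommRing R] [IsDomain R] [IsPrincipalIdealRing R] {p : R}

theorem isFiniteLength_cyclic (hp : Prime p) (m : ℕ) : IsFiniteLength R (cyclic p m) :=
  isFiniteLength_quotient_span_singleton R
    (mem_nonZeroDivisors_of_ne_zero (pow_ne_zero m hp.ne_zero))

/-- The picket `P_ℓ^m`, for `ℓ ≤ m`: the submodule `(p^(m-ℓ))` of `P^m = R/(p^m)`. -/
def picket (hp : Prime p) (ℓ m : ℕ) : PEmbedding R p where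
  carrier := cyclic p m
  sub := Submodule.span R {Ideal.Quotient.mk _ (p ^ (m - ℓ))}
  isFiniteLength := isFiniteLength_cyclic hp m
  exists_pow_smul_eq_zero := ⟨m, pow_smul_cyclic p le_rfl⟩

/-- The bipicket `T_2^{m,r}`, for `1 ≤ r ≤ m - 2`: the submodule of `P^m ⊕ P^r` generated by
the element `(p^(m-2), p^(r-1))`. -/
def bipicket (hp : Prime p) (m r : ℕ) : PEmbedding R p where
  carrier := cyclic p m × cyclic p r
  sub := Submodule.span R
    {(Ideal.Quotient.mk _ (p ^ (m - 2)), Ideal.Quotient.mk _ (p ^ (r - 1)))}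
  isFiniteLength := by
    have h₁ := isFiniteLength_iff_isNoetherian_isArtinian.1 (isFiniteLength_cyclic hp m)
    have h₂ := isFiniteLength_iff_isNoetherian_isArtinian.1 (isFiniteLength_cyclic hp r)
    have := h₁.1
    have := h₁.2
    have := h₂.1
    have := h₂.2
    exact isFiniteLength_iff_isNoetherian_isArtinian.2 ⟨inferInstance, inferInstance⟩
  exists_pow_smul_eq_zero := ⟨max m r, fun x => Prod.ext
    (pow_smul_cyclic p (le_max_left m r) x.1) (pow_smul_cyclic p (le_max_right m r) x.2)⟩

end Objects

end PEmbedding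

/-! Everything reduces to counting solutions of linear equations in P^m. A morphism out of a picket
or bipicket is determined by the images of its generators, subject to annihilation by powers of p
and one membership in the target's subobject. That membership is itself given by equations:
annihilation by p^ℓ for a picket (`mem_picket_sub_iff`), a coupling of the two coordinates for a
bipicket (`mem_bipicket_sub_iff`).

Embedding P^r in P^m as the annihilator of p^r puts all unknowns in P^m. Where equations stay
coupled, a shear (y, z) ↦ (y, z + cy) separates them. What remains are annihilators, each of size
q^min(k, m) (`card_annihilator`).

For automorphisms, injectivity is tested on the socle. For both kinds of object, an endomorphism
fails to be invertible exactly when p^(m-1) kills its first diagonal entry. Such endomorphisms make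
up a fraction 1/q of the total, whence the factor 1 - 1/q. -/

namespace PEmbedding

/-! ### Cyclic modules, their annihilators, and equations for the subobjects -/

section Cyclic

variable {R : Type u} [CommRing R] {p : R} {m : ℕ}

theorem mk_eq_smul_one (c : R) : (Ideal.Quotient.mk _ c : cyclic p m) = c • 1 := by
  rw [Algebra.smul_def, Ideal.Quotient.algebraMap_eq, mul_one]

theorem exists_smul_one_eq (x : cyclic p m) : ∃ c : R, c • 1 = x := by
  obtain ⟨c, rfl⟩ := Ideal.Quotient.mk_surjective x
  exact ⟨c, (mk_eq_smul_one c).symm⟩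

theorem smul_one_eq_zero_iff {c : R} : c • (1 : cyclic p m) = 0 ↔ p ^ m ∣ c := by
  rw [← mk_eq_smul_one, Ideal.Quotient.eq_zero_iff_mem, Ideal.mem_span_singleton]

/-- The linear map `P^v → M` sending `1` to an element `y` with `p^v y = 0`. -/
def cyclicLift {M : Type*} [AddCommGroup M] [Module R M] (v : ℕ) (y : M) (hy : p ^ v • y = 0) :
    cyclic p v →ₗ[R] M :=
  Submodule.liftQ _ (LinearMap.toSpanSingleton R M y) <| by
    rw [Ideal.span, Submodule.span_singleton_le_iff_mem, LinearMap.mem_ker,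
      LinearMap.toSpanSingleton_apply, hy]

theorem cyclicLift_one {M : Type*} [AddCommGroup M] [Module R M] (v : ℕ) (y : M)
    (hy : p ^ v • y = 0) : cyclicLift v y hy (1 : cyclic p v) = y :=
  one_smul R y

theorem cyclic_hom_ext {M : Type*} [AddCommGroup M] [Module R M] {v : ℕ}
    {f g : cyclic p v →ₗ[R] M} (h : f 1 = g 1) : f = g := by
  refine LinearMap.ext fun x => ?_
  obtain ⟨c, rfl⟩ := exists_smul_one_eq x
  rw [map_smul, map_smul, h]

theorem map_one_annihilated {M : Type*} [AddCommGroup M] [Module R M] {v : ℕ}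
    (f : cyclic p v →ₗ[R] M) : p ^ v • f 1 = 0 := by
  rw [← map_smul, pow_smul_cyclic p le_rfl, map_zero]

/-- Linear maps `P^v → M` correspond to the elements of `M` annihilated by `p^v`. -/
def cyclicHomEquiv (M : Type*) [AddCommGroup M] [Module R M] (v : ℕ) :
    (cyclic p v →ₗ[R] M) ≃ {y : M // p ^ v • y = 0} where
  toFun f := ⟨f 1, map_one_annihilated f⟩
  invFun y := cyclicLift v y.1 y.2
  left_inv _ := cyclic_hom_ext (cyclicLift_one v _ _)
  right_inv _ := Subtype.ext (cyclicLift_one v _ _)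

/-- The map `P^r → P^m` given by multiplication by `p^(m-r)`, for `r ≤ m`. -/
def cyclicEmb (p : R) {r m : ℕ} (h : r ≤ m) : cyclic p r →ₗ[R] cyclic p m :=
  cyclicLift r (p ^ (m - r) • 1) <| by
    rw [smul_smul, ← pow_add, pow_smul_cyclic p (by omega)]

theorem cyclicEmb_smul_one {r : ℕ} (h : r ≤ m) (c : R) :
    cyclicEmb p h (c • 1) = (c * p ^ (m - r)) • 1 := by
  rw [map_smul, cyclicEmb, cyclicLift_one, smul_smul]

variable [IsDomain R]

theorem cyclicEmb_injective (hp : Prime p) {r : ℕ} (h : r ≤ m) :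
    Function.Injective (cyclicEmb p h) := by
  rw [injective_iff_map_eq_zero]
  intro x hx
  obtain ⟨c, rfl⟩ := exists_smul_one_eq x
  rw [cyclicEmb_smul_one, smul_one_eq_zero_iff, ← Nat.add_sub_cancel' h, pow_add,
    Nat.add_sub_cancel_left] at hx
  exact smul_one_eq_zero_iff.2 ((mul_dvd_mul_iff_right (pow_ne_zero _ hp.ne_zero)).1 hx)

theorem exists_pow_smul_eq (hp : Prime p) {k : ℕ} (h : k ≤ m) {x : cyclic p m}
    (hx : p ^ k • x = 0) : ∃ c : R, x = (c * p ^ (m - k)) • 1 := by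
  obtain ⟨c, rfl⟩ := exists_smul_one_eq x
  have e : p ^ m = p ^ k * p ^ (m - k) := by rw [← pow_add, Nat.add_sub_cancel' h]
  rw [smul_smul, smul_one_eq_zero_iff, e, mul_dvd_mul_iff_left (pow_ne_zero _ hp.ne_zero)] at hx
  obtain ⟨d, rfl⟩ := hx
  exact ⟨d, by rw [mul_comm]⟩

/-- `P^r` is isomorphic to the annihilator of `p^r` in `P^m`, for `r ≤ m`. -/
noncomputable def cyclicEquivAnnihilator (hp : Prime p) {r m : ℕ} (h : r ≤ m) :
    cyclic p r ≃ {x : cyclic p m // p ^ r • x = 0} :=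
  Equiv.ofBijective
    (fun x => ⟨cyclicEmb p h x, by rw [← map_smul, pow_smul_cyclic p le_rfl, map_zero]⟩) <| by
    refine ⟨fun x y hxy => cyclicEmb_injective hp h (congrArg Subtype.val hxy), ?_⟩
    rintro ⟨x, hx⟩
    obtain ⟨c, rfl⟩ := exists_pow_smul_eq hp h hx
    exact ⟨c • 1, Subtype.ext (cyclicEmb_smul_one h c)⟩

variable [IsPrincipalIdealRing R]

theorem card_cyclic (hp : Prime p) (m : ℕ) :
    Nat.card (cyclic p m) = Nat.card (R ⧸ Ideal.span {p}) ^ m := by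
  have := (Ideal.span_singleton_prime hp.ne_zero).2 hp
  rw [cyclic, ← Ideal.span_singleton_pow, ← Submodule.cardQuot_apply, ← Submodule.cardQuot_apply]
  exact cardQuot_pow_of_prime (by simpa using hp.ne_zero)

/-- For k ≤ m the annihilator of p^k is a copy of P^k; for k ≥ m it is all of P^m. -/
theorem card_annihilator (hp : Prime p) (k m : ℕ) :
    Nat.card {x : cyclic p m // p ^ k • x = 0} = Nat.card (R ⧸ Ideal.span {p}) ^ min k m := by
  rcases le_total k m with h | h
  · rw [← Nat.card_congr (cyclicEquivAnnihilator hp h), card_cyclic hp, min_eq_left h]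
  · rw [Nat.card_congr (Equiv.subtypeUnivEquiv (pow_smul_cyclic p h)), card_cyclic hp,
      min_eq_right h]

theorem finite_cyclic (hp : Prime p) [Finite (R ⧸ Ideal.span {p})] (m : ℕ) :
    Finite (cyclic p m) := by
  refine Nat.finite_of_card_ne_zero ?_
  rw [card_cyclic hp]
  have := (Ideal.span_singleton_prime hp.ne_zero).2 hp
  exact pow_ne_zero _ Nat.card_pos.ne'

/-- An element not divisible by `p` acts faithfully on elements annihilated by `p`. -/
theorem dvd_of_smul_eq_zero (hp : Prime p) {M : Type*} [AddCommGroup M] [Module R M] {c : R}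
    {x : M} (hx : p • x = 0) (hx₀ : x ≠ 0) (hc : c • x = 0) : p ∣ c := by
  by_contra h
  -- Bézout: x is a combination of p x and c x, both zero.
  obtain ⟨s, t, hst⟩ := (hp.irreducible.coprime_iff_not_dvd).2 h
  refine hx₀ ?_
  rw [← one_smul R x, ← hst, add_smul, mul_smul, mul_smul, hx, hc, smul_zero, smul_zero, add_zero]

/-- The subobject of a picket is the annihilator of `p^ℓ`. -/
theorem mem_picket_sub_iff (hp : Prime p) {ℓ m : ℕ} (h : ℓ ≤ m) {x : cyclic p m} :
    x ∈ (picket hp ℓ m).sub ↔ p ^ ℓ • x = 0 := by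
  change x ∈ Submodule.span R {Ideal.Quotient.mk _ (p ^ (m - ℓ))} ↔ _
  rw [Submodule.mem_span_singleton, mk_eq_smul_one]
  constructor
  · rintro ⟨c, rfl⟩
    rw [smul_comm, smul_smul (p ^ ℓ), ← pow_add, pow_smul_cyclic p (by omega), smul_zero]
  · intro hx
    obtain ⟨c, rfl⟩ := exists_pow_smul_eq hp h hx
    exact ⟨c, by rw [smul_smul]⟩

/-- Membership in the subobject of a bipicket, in terms of the embedding `P^r → P^m`. -/
theorem mem_bipicket_sub_iff (hp : Prime p) {m r : ℕ} (hr : 1 ≤ r) (hm : r + 2 ≤ m)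
    {x : cyclic p m × cyclic p r} :
    x ∈ (bipicket hp m r).sub ↔
      p ^ 2 • x.1 = 0 ∧ p • x.1 = cyclicEmb p (show r ≤ m by omega) x.2 := by
  change x ∈ Submodule.span R
    {(Ideal.Quotient.mk _ (p ^ (m - 2)), Ideal.Quotient.mk _ (p ^ (r - 1)))} ↔ _
  rw [Submodule.mem_span_singleton, mk_eq_smul_one, mk_eq_smul_one]
  -- Both sides are p^(m-1): p times the generator's first coordinate is the embedded second one.
  have e₁ : p * p ^ (m - 2) = p ^ (r - 1) * p ^ (m - r) := by
    rw [← pow_succ', ← pow_add]; congr 1; omega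
  constructor
  · rintro ⟨c, rfl⟩
    refine ⟨?_, ?_⟩
    · simp only [Prod.smul_fst]
      rw [smul_comm, smul_smul (p ^ 2), ← pow_add, pow_smul_cyclic p (by omega), smul_zero]
    · simp only [Prod.smul_fst, Prod.smul_snd]
      rw [smul_comm, smul_smul p, map_smul, cyclicEmb_smul_one, e₁]
  · obtain ⟨x₁, x₂⟩ := x
    rintro ⟨h₁, h₂⟩
    obtain ⟨c, rfl⟩ := exists_pow_smul_eq hp (by omega) h₁
    refine ⟨c, Prod.ext ?_ (cyclicEmb_injective hp (by omega) (Eq.trans ?_ h₂))⟩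
    · simp only [Prod.smul_fst, smul_smul]
    · simp only [Prod.smul_snd]
      rw [map_smul, cyclicEmb_smul_one, ← e₁, smul_smul, smul_smul, mul_left_comm]

end Cyclic

/-! ### Morphisms as tuples of images of generators -/

section Homs

variable {R : Type u} [CommRing R] [IsDomain R] [IsPrincipalIdealRing R] {p : R}

theorem map_picket_sub_le_iff (hp : Prime p) {u v : ℕ} {M : Type*} [AddCommGroup M] [Module R M]
    {N : Submodule R M} (f : cyclic p v →ₗ[R] M) :
    Submodule.map f (picket hp u v).sub ≤ N ↔ p ^ (v - u) • f 1 ∈ N := by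
  change Submodule.map f (Submodule.span R {Ideal.Quotient.mk _ (p ^ (v - u))}) ≤ N ↔ _
  rw [mk_eq_smul_one, Submodule.map_span_le, ← map_smul]
  simp only [Set.mem_singleton_iff, forall_eq]

theorem map_bipicket_sub_le_iff (hp : Prime p) {v w : ℕ} {M : Type*} [AddCommGroup M] [Module R M]
    {N : Submodule R M} (f : cyclic p v × cyclic p w →ₗ[R] M) :
    Submodule.map f (bipicket hp v w).sub ≤ N ↔
      p ^ (v - 2) • f (1, 0) + p ^ (w - 1) • f (0, 1) ∈ N := by
  change Submodule.map f (Submodule.span R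
    {(Ideal.Quotient.mk _ (p ^ (v - 2)), Ideal.Quotient.mk _ (p ^ (w - 1)))}) ≤ N ↔ _
  have e : ((Ideal.Quotient.mk _ (p ^ (v - 2)), Ideal.Quotient.mk _ (p ^ (w - 1))) :
      cyclic p v × cyclic p w) = p ^ (v - 2) • (1, 0) + p ^ (w - 1) • (0, 1) := by
    rw [mk_eq_smul_one, mk_eq_smul_one, Prod.smul_mk, Prod.smul_mk, Prod.mk_add_mk, smul_zero,
      smul_zero, add_zero, zero_add]
  rw [e, Submodule.map_span_le, ← map_smul, ← map_smul, ← map_add]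
  simp only [Set.mem_singleton_iff, forall_eq]

/-- Linear maps `P^v ⊕ P^w → M` correspond to pairs of elements of `M` annihilated by `p^v` and
`p^w`. -/
def prodCyclicHomEquiv (M : Type*) [AddCommGroup M] [Module R M] (v w : ℕ) :
    (cyclic p v × cyclic p w →ₗ[R] M) ≃ {y : M × M // p ^ v • y.1 = 0 ∧ p ^ w • y.2 = 0} where
  toFun f := ⟨(f (1, 0), f (0, 1)),
    map_one_annihilated (f ∘ₗ LinearMap.inl R _ _), map_one_annihilated (f ∘ₗ LinearMap.inr R _ _)⟩
  invFun y := (cyclicLift v y.1.1 y.2.1).coprod (cyclicLift w y.1.2 y.2.2)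
  left_inv _ := LinearMap.prod_ext
    (cyclic_hom_ext <| by
      rw [LinearMap.comp_apply, LinearMap.inl_apply, LinearMap.coprod_apply, cyclicLift_one,
        map_zero, add_zero, LinearMap.comp_apply, LinearMap.inl_apply])
    (cyclic_hom_ext <| by
      rw [LinearMap.comp_apply, LinearMap.inr_apply, LinearMap.coprod_apply, cyclicLift_one,
        map_zero, zero_add, LinearMap.comp_apply, LinearMap.inr_apply])
  right_inv _ := Subtype.ext <| Prod.ext
    (by dsimp only; rw [LinearMap.coprod_apply, cyclicLift_one, map_zero, add_zero])
    (by dsimp only; rw [LinearMap.coprod_apply, cyclicLift_one, map_zero, zero_add])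

/-- Morphisms of embeddings as linear maps preserving the subobjects. -/
def homEquivSubtype (X Y : PEmbedding R p) :
    (X ⟶ Y) ≃ {f : X.carrier →ₗ[R] Y.carrier // X.sub.map f ≤ Y.sub} where
  toFun f := ⟨f.toLinearMap, f.map_le⟩
  invFun f := ⟨f.1, f.2⟩
  left_inv _ := rfl
  right_inv _ := rfl

/-- Morphisms from a picket correspond to images of the generator. -/
def picketHomEquiv (hp : Prime p) (u v : ℕ) (Y : PEmbedding R p) :
    (picket hp u v ⟶ Y) ≃ {y : Y.carrier // p ^ v • y = 0 ∧ p ^ (v - u) • y ∈ Y.sub} :=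
  (homEquivSubtype _ _).trans <|
    ((cyclicHomEquiv (p := p) Y.carrier v).subtypeEquiv
      (q := fun y => p ^ (v - u) • y.1 ∈ Y.sub) fun f => map_picket_sub_le_iff hp f).trans
    (Equiv.subtypeSubtypeEquivSubtypeInter _ fun y => p ^ (v - u) • y ∈ Y.sub)

/-- Morphisms from a bipicket correspond to pairs of images of the two generators. -/
def bipicketHomEquiv (hp : Prime p) (v w : ℕ) (Y : PEmbedding R p) :
    (bipicket hp v w ⟶ Y) ≃ {y : Y.carrier × Y.carrier //
      (p ^ v • y.1 = 0 ∧ p ^ w • y.2 = 0) ∧ p ^ (v - 2) • y.1 + p ^ (w - 1) • y.2 ∈ Y.sub} :=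
  (homEquivSubtype _ _).trans <|
    ((prodCyclicHomEquiv (p := p) Y.carrier v w).subtypeEquiv
      (q := fun y => p ^ (v - 2) • y.1.1 + p ^ (w - 1) • y.1.2 ∈ Y.sub)
      fun f => map_bipicket_sub_le_iff hp f).trans
    (Equiv.subtypeSubtypeEquivSubtypeInter _
      fun y : Y.carrier × Y.carrier => p ^ (v - 2) • y.1 + p ^ (w - 1) • y.2 ∈ Y.sub)

end Homs

end PEmbedding

namespace PEmbedding

/-! ### Counting morphisms that involve a picket -/

section Counts

variable {R : Type u} [CommRing R] {p : R} {M : Type*} [AddCommGroup M] [Module R M]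

theorem pow_smul_eq_zero_of_le {a b : ℕ} (h : a ≤ b) {y : M} (hy : p ^ a • y = 0) :
    p ^ b • y = 0 := by
  rw [← Nat.sub_add_cancel h, pow_add, mul_smul, hy, smul_zero]

theorem pow_min_smul_eq_zero_iff {a b : ℕ} {y : M} :
    p ^ min a b • y = 0 ↔ p ^ a • y = 0 ∧ p ^ b • y = 0 := by
  refine ⟨fun h => ⟨pow_smul_eq_zero_of_le (min_le_left _ _) h,
    pow_smul_eq_zero_of_le (min_le_right _ _) h⟩, fun h => ?_⟩
  rcases min_choice a b with e | e <;> rw [e]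
  exacts [h.1, h.2]

/-- The shear `(x, y) ↦ (x, y + c x)`. -/
def shear (M : Type*) [AddCommGroup M] [Module R M] (c : R) : M × M ≃ M × M where
  toFun y := (y.1, y.2 + c • y.1)
  invFun y := (y.1, y.2 - c • y.1)
  left_inv y := by simp
  right_inv y := by simp

theorem card_eq_of_shear (c : R) {P Q : M × M → Prop}
    (h : ∀ y z, P (y, z) ↔ Q (y, z + c • y)) : Nat.card {y // P y} = Nat.card {y // Q y} :=
  Nat.card_congr ((shear M c).subtypeEquiv fun y => h y.1 y.2)

variable [IsDomain R]

/-- Trades a P^r coordinate for one in P^m, so that shears, which need both coordinates in the same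
module, become available. -/
theorem card_cyclicEmb (hp : Prime p) {α : Type*} {m r : ℕ} (h : r ≤ m)
    (P : α → cyclic p m → Prop) :
    Nat.card {x : α × cyclic p r // P x.1 (cyclicEmb p h x.2)} =
      Nat.card {x : α × cyclic p m // p ^ r • x.2 = 0 ∧ P x.1 x.2} := by
  refine Nat.card_congr (Equiv.ofBijective (fun x => ⟨(x.1.1, cyclicEmb p h x.1.2),
    (cyclicEquivAnnihilator hp h x.1.2).2, x.2⟩) ⟨?_, ?_⟩)
  · rintro ⟨⟨a, x⟩, hx⟩ ⟨⟨b, y⟩, hy⟩ hxy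
    have := congrArg Subtype.val hxy
    simp only [Prod.mk.injEq] at this
    exact Subtype.ext (Prod.ext this.1 (cyclicEmb_injective hp h this.2))
  · rintro ⟨⟨a, y⟩, hy, hP⟩
    obtain ⟨x, hx⟩ := (cyclicEquivAnnihilator hp h).surjective ⟨y, hy⟩
    obtain rfl : cyclicEmb p h x = y := congrArg Subtype.val hx
    exact ⟨⟨(a, x), hP⟩, rfl⟩

variable [IsPrincipalIdealRing R]

theorem card_annihilator_prod (hp : Prime p) (a b m n : ℕ) :
    Nat.card {x : cyclic p m × cyclic p n // p ^ a • x.1 = 0 ∧ p ^ b • x.2 = 0} =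
      Nat.card (R ⧸ Ideal.span {p}) ^ (min a m + min b n) := by
  rw [Nat.card_congr (Equiv.subtypeProdEquivProd (p := fun x : cyclic p m => p ^ a • x = 0)
    (q := fun x : cyclic p n => p ^ b • x = 0)), Nat.card_prod, card_annihilator hp,
    card_annihilator hp, pow_add]

theorem card_picket_hom_picket (hp : Prime p) {u v ℓ m : ℕ} (hu : u ≤ v) (hℓ : ℓ ≤ m) :
    Nat.card (picket hp u v ⟶ picket hp ℓ m) =
      Nat.card (R ⧸ Ideal.span {p}) ^ min m (v - max 0 (u - ℓ)) := by
  let e : (picket hp u v ⟶ picket hp ℓ m) ≃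
      {y : cyclic p m // p ^ min v (v - u + ℓ) • y = 0} :=
    (picketHomEquiv hp u v (picket hp ℓ m)).trans <| Equiv.subtypeEquivRight fun (y : cyclic p m) => by
      rw [pow_min_smul_eq_zero_iff, add_comm, pow_add, mul_smul]
      refine and_congr_right fun _ => mem_picket_sub_iff hp hℓ
  rw [Nat.card_congr e, card_annihilator hp]
  congr 1
  omega

theorem card_bipicket_hom_picket (hp : Prime p) {v w ℓ m : ℕ} (hw : 1 ≤ w) (hv : w + 2 ≤ v)
    (hℓ : ℓ ≤ m) :
    Nat.card (bipicket hp v w ⟶ picket hp ℓ m) =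
      if ℓ = 0 then Nat.card (R ⧸ Ideal.span {p}) ^ (min (v - 1) m + min (w - 1) m)
      else if ℓ = 1 then Nat.card (R ⧸ Ideal.span {p}) ^ (min (v - 1) m + min w m)
      else Nat.card (R ⧸ Ideal.span {p}) ^ (min v m + min w m) := by
  let e : (bipicket hp v w ⟶ picket hp ℓ m) ≃ {y : cyclic p m × cyclic p m //
      (p ^ v • y.1 = 0 ∧ p ^ w • y.2 = 0) ∧ p ^ ℓ • (p ^ (v - 2) • y.1 + p ^ (w - 1) • y.2) = 0} :=
    (bipicketHomEquiv hp v w (picket hp ℓ m)).trans <| Equiv.subtypeEquivRight fun y =>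
      and_congr_right fun _ => mem_picket_sub_iff hp hℓ
  rw [Nat.card_congr e]
  obtain ⟨w, rfl⟩ := Nat.exists_eq_add_of_le' hw
  -- With w shifted by one, this parametrises v ≥ w + 2 and removes truncated subtraction from the
  -- exponents.
  obtain ⟨d, rfl⟩ : ∃ d, v = d + w + 3 := ⟨v - (w + 3), by omega⟩
  rw [show d + w + 3 - 2 = d + w + 1 from rfl, show d + w + 3 - 1 = d + w + 2 from rfl,
    Nat.add_sub_cancel]
  clear e
  split_ifs with h₀ h₁
  · subst h₀
    rw [← card_annihilator_prod hp]
    -- In the shifted notation the sum factors as p^w (z + p^(d+1) y).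
    refine card_eq_of_shear (p ^ (d + 1)) fun y z => ⟨?_, ?_⟩
    · rintro ⟨⟨h₁, h₂⟩, h₃⟩
      dsimp only at h₁ h₂ h₃ ⊢
      refine ⟨?_, ?_⟩
      · linear_combination (norm := module) p • h₃ - h₂
      · linear_combination (norm := module) h₃
    · rintro ⟨h₁, h₂⟩
      dsimp only at h₁ h₂ ⊢
      refine ⟨⟨?_, ?_⟩, ?_⟩
      · linear_combination (norm := module) p • h₁
      · linear_combination (norm := module) p • h₂ - h₁
      · linear_combination (norm := module) h₂
  · subst h₁
    rw [← card_annihilator_prod hp]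
    -- For ℓ = 1 the extra factor p already kills the second summand, so only the first is
    -- constrained.
    refine Nat.card_congr (Equiv.subtypeEquivRight fun y => ⟨?_, ?_⟩)
    · rintro ⟨⟨h₁, h₂⟩, h₃⟩
      refine ⟨?_, h₂⟩
      linear_combination (norm := module) h₃ - h₂
    · rintro ⟨h₁, h₂⟩
      refine ⟨⟨?_, h₂⟩, ?_⟩
      · linear_combination (norm := module) p • h₁
      · linear_combination (norm := module) h₁ + h₂
  · rw [← card_annihilator_prod hp]
    refine Nat.card_congr (Equiv.subtypeEquivRight fun y => ⟨And.left, fun h => ⟨h, ?_⟩⟩)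
    refine pow_smul_eq_zero_of_le (show 2 ≤ ℓ by omega) ?_
    linear_combination (norm := module) h.1 + p • h.2

theorem card_picket_hom_bipicket (hp : Prime p) {u v m r : ℕ} (hu : u ≤ v) (hr : 1 ≤ r)
    (hm : r + 2 ≤ m) :
    Nat.card (picket hp u v ⟶ bipicket hp m r) =
      if u = 0 then Nat.card (R ⧸ Ideal.span {p}) ^ (min v r + min v m)
      else if u = 1 then Nat.card (R ⧸ Ideal.span {p}) ^ (min (v - 1) r + min v m)
      else Nat.card (R ⧸ Ideal.span {p}) ^ (min (v - u + 1) r + min (v - u + 1) m) := by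
  have hrm : r ≤ m := by omega
  -- Here z stands for the embedded second coordinate.
  let P (y z : cyclic p m) : Prop := (p ^ v • y = 0 ∧ p ^ v • z = 0) ∧
    p ^ 2 • p ^ (v - u) • y = 0 ∧ p • p ^ (v - u) • y = p ^ (v - u) • z
  let e : (picket hp u v ⟶ bipicket hp m r) ≃
      {y : cyclic p m × cyclic p r // P y.1 (cyclicEmb p hrm y.2)} :=
    (picketHomEquiv hp u v (bipicket hp m r)).trans <| Equiv.subtypeEquivRight fun y => by
      refine and_congr (Prod.ext_iff.trans (and_congr_right fun _ => ?_))
        ((mem_bipicket_sub_iff hp hr hm).trans (and_congr_right fun _ => ?_))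
      · rw [← map_smul, map_eq_zero_iff _ (cyclicEmb_injective hp hrm)]
        rfl
      · rw [← map_smul]
        rfl
  rw [Nat.card_congr e, card_cyclicEmb hp hrm]
  simp only [P]
  clear e P
  obtain ⟨k, rfl⟩ := Nat.exists_eq_add_of_le' hu
  rw [Nat.add_sub_cancel]
  split_ifs with h₀ h₁
  · subst h₀
    rw [show min (k + 0) r + min (k + 0) m = min k m + min (min k r) m by omega,
      ← card_annihilator_prod hp]
    refine Nat.card_congr (Equiv.subtypeEquivRight fun y => ?_)
    rw [pow_min_smul_eq_zero_iff, add_zero]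
    refine ⟨fun h => ⟨h.2.1.1, h.2.1.2, h.1⟩, fun h => ⟨h.2.2, ⟨h.1, h.2.1⟩, ?_, ?_⟩⟩
    · rw [h.1, smul_zero]
    · rw [h.1, h.2.1, smul_zero]
  · subst h₁
    rw [show min (k + 1 - 1) r + min (k + 1) m = min (k + 1) m + min (min k r) m by omega,
      ← card_annihilator_prod hp]
    refine Nat.card_congr (Equiv.subtypeEquivRight fun y => ?_)
    rw [pow_min_smul_eq_zero_iff]
    constructor
    · rintro ⟨h₁, ⟨h₂, h₃⟩, h₄, h₅⟩
      refine ⟨h₂, ?_, h₁⟩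
      linear_combination (norm := module) h₂ - h₅
    · rintro ⟨h₁, h₂, h₃⟩
      refine ⟨h₃, ⟨h₁, ?_⟩, ?_, ?_⟩
      · linear_combination (norm := module) p • h₂
      · linear_combination (norm := module) p • h₁
      · linear_combination (norm := module) h₁ - h₂
  · have hku : k + 2 ≤ k + u := by omega
    -- If r ≤ k, then p^k z = 0 and the coupling becomes p^(k+1) y = 0. Otherwise it stays genuine
    -- and is separated by z ↦ z - p y; then p^(k+1) z = 0, so annihilation of z by p^r is
    -- automatic.
    rcases le_or_gt r k with hk | hk
    · rw [show min (k + 1) r + min (k + 1) m = min (k + 1) m + min r m by omega,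
        ← card_annihilator_prod hp]
      refine Nat.card_congr (Equiv.subtypeEquivRight fun y => ?_)
      constructor
      · rintro ⟨h₁, -, h₄, h₅⟩
        refine ⟨?_, h₁⟩
        have h₂ := pow_smul_eq_zero_of_le hk h₁
        linear_combination (norm := module) h₅ + h₂
      · rintro ⟨h₁, h₂⟩
        have h₃ := pow_smul_eq_zero_of_le hk h₂
        refine ⟨h₂, ⟨pow_smul_eq_zero_of_le (by omega) h₁, pow_smul_eq_zero_of_le (by omega) h₂⟩,
          ?_, ?_⟩
        · linear_combination (norm := module) p • h₁
        · linear_combination (norm := module) h₁ - h₃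
    -- Both sides are 2k + 2, since k < r ≤ m - 2.
    · rw [show min (k + 1) r + min (k + 1) m = min (k + 2) m + min k m by omega,
        ← card_annihilator_prod hp]
      refine card_eq_of_shear (-p) fun y z => ⟨?_, ?_⟩
      · rintro ⟨h₁, -, h₄, h₅⟩
        dsimp only at h₁ h₄ h₅ ⊢
        refine ⟨?_, ?_⟩
        · linear_combination (norm := module) h₄
        · linear_combination (norm := module) -h₅
      · rintro ⟨h₁, h₂⟩
        dsimp only at h₁ h₂ ⊢
        have h₃ : p ^ (k + 1) • z = 0 := by
          linear_combination (norm := module) h₁ + p • h₂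
        refine ⟨pow_smul_eq_zero_of_le (by omega) h₃, ⟨pow_smul_eq_zero_of_le hku h₁,
          pow_smul_eq_zero_of_le (by omega) h₃⟩, ?_, ?_⟩
        · linear_combination (norm := module) h₁
        · linear_combination (norm := module) -h₂

end Counts

end PEmbedding

namespace PEmbedding

/-! ### Recognising automorphisms on the socle -/

section Isomorphisms

variable {R : Type u} [CommRing R] {p : R}

theorem injective_of_isIso {X Y : PEmbedding R p} (f : X ⟶ Y) [IsIso f] :
    Function.Injective f.toLinearMap := by
  refine Function.LeftInverse.injective (g := (inv f).toLinearMap) fun x => ?_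
  exact LinearMap.congr_fun (congrArg Hom.toLinearMap (IsIso.hom_inv_id f)) x

/-- By finiteness f is bijective and the inclusion f(A) ⊆ A is an equality, so the inverse also
preserves A. -/
theorem isIso_of_injective {X : PEmbedding R p} [Finite X.carrier] (f : X ⟶ X)
    (hf : Function.Injective f.toLinearMap) : IsIso f := by
  let e := LinearEquiv.ofBijective f.toLinearMap (Finite.injective_iff_bijective.1 hf)
  have hsub : X.sub.map f.toLinearMap = X.sub :=
    SetLike.coe_injective <| Set.eq_of_subset_of_ncard_le f.map_le
      (by rw [Submodule.map_coe, Set.ncard_image_of_injective _ hf]) (Set.toFinite _)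
  refine ⟨⟨⟨e.symm, ?_⟩, Hom.ext (LinearMap.ext e.symm_apply_apply),
    Hom.ext (LinearMap.ext e.apply_symm_apply)⟩⟩
  rintro _ ⟨x, hx, rfl⟩
  rw [SetLike.mem_coe, ← hsub] at hx
  obtain ⟨y, hy, rfl⟩ := hx
  exact (congrArg (· ∈ X.sub) (e.symm_apply_apply y)).mpr hy

/-- A linear map out of a `p`-module is injective if it is injective on the elements annihilated
by `p`. -/
theorem injective_of_socle (X : PEmbedding R p) {M : Type*} [AddCommGroup M] [Module R M]
    (f : X.carrier →ₗ[R] M) (h : ∀ x, p • x = 0 → f x = 0 → x = 0) : Function.Injective f := by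
  obtain ⟨n, hn⟩ := X.exists_pow_smul_eq_zero
  rw [injective_iff_map_eq_zero]
  intro x hx
  have key : ∀ n : ℕ, p ^ n • x = 0 → x = 0 := by
    intro n
    induction n with
    | zero => intro h₀; rwa [pow_zero, one_smul] at h₀
    | succ n ih =>
      intro h₁
      refine ih (h _ ?_ ?_)
      · rwa [smul_smul, ← pow_succ']
      · rw [map_smul, hx, smul_zero]
  exact key n (hn x)

/-- Automorphisms are the invertible endomorphisms. -/
noncomputable def autEquivIsIso {C : Type*} [Category* C] (X : C) :
    Aut X ≃ {f : X ⟶ X // IsIso f} where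
  toFun α := ⟨α.hom, Iso.isIso_hom α⟩
  invFun f := @asIso _ _ _ _ f.1 f.2
  left_inv _ := Iso.ext rfl
  right_inv _ := rfl

theorem card_aut_add_card {C : Type*} [Category* C] (X : C) [Finite (X ⟶ X)] {D : (X ⟶ X) → Prop}
    (h : ∀ f, IsIso f ↔ ¬ D f) :
    Nat.card (Aut X) + Nat.card {f // D f} = Nat.card (X ⟶ X) := by
  classical
  rw [Nat.card_congr ((autEquivIsIso X).trans (Equiv.subtypeEquivRight h)), add_comm,
    ← Nat.card_sum, Nat.card_congr (Equiv.sumCompl D)]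

variable [IsDomain R] [IsPrincipalIdealRing R]

theorem isIso_picket_iff (hp : Prime p) [Finite (R ⧸ Ideal.span {p})] {ℓ m : ℕ} (hm : 1 ≤ m)
    (f : picket hp ℓ m ⟶ picket hp ℓ m) :
    IsIso f ↔ ¬ p ^ (m - 1) • (picketHomEquiv hp ℓ m _ f).1 = 0 := by
  let g : cyclic p m →ₗ[R] cyclic p m := f.toLinearMap
  change _ ↔ ¬ p ^ (m - 1) • g 1 = 0
  constructor
  · intro _ h
    have hg : Function.Injective g := injective_of_isIso f
    rw [← map_smul, map_eq_zero_iff _ hg, smul_one_eq_zero_iff,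
      pow_dvd_pow_iff hp.ne_zero hp.not_isUnit] at h
    omega
  · intro h
    have : Finite (picket hp ℓ m).carrier := finite_cyclic hp m
    refine isIso_of_injective f (injective_of_socle _ _ fun (x : cyclic p m) hx (hfx : g x = 0) => ?_)
    change x = 0
    obtain ⟨c, rfl⟩ := exists_pow_smul_eq hp hm (show p ^ 1 • x = 0 by rw [pow_one]; exact hx)
    rw [map_smul, mul_smul] at hfx
    obtain ⟨d, rfl⟩ := dvd_of_smul_eq_zero hp
      (by rw [smul_smul, ← pow_succ', pow_smul_cyclic p (by omega)]) h hfx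
    rw [mul_right_comm, ← pow_succ', mul_smul, pow_smul_cyclic p (by omega)]

/-- On the socle, spanned by p^(m-1) e₁ and p^(r-1) e₂, an endomorphism is triangular because
p^(m-1) kills P^r. Preserving the subobject ties the two diagonal entries together (`hdiag`), so one
of them decides invertibility. -/
theorem isIso_bipicket_iff (hp : Prime p) [Finite (R ⧸ Ideal.span {p})] {m r : ℕ} (hr : 1 ≤ r)
    (hm : r + 2 ≤ m) (f : bipicket hp m r ⟶ bipicket hp m r) :
    IsIso f ↔ ¬ p ^ (m - 1) • (bipicketHomEquiv hp m r _ f).1.1.1 = 0 := by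
  have hrm : r ≤ m := by omega
  let g : cyclic p m × cyclic p r →ₗ[R] cyclic p m × cyclic p r := f.toLinearMap
  change _ ↔ ¬ p ^ (m - 1) • (g (1, 0)).1 = 0
  constructor
  · intro _ h
    have hg : Function.Injective g := injective_of_isIso f
    have h' : g (p ^ (m - 1) • (1, 0)) = 0 := by
      rw [map_smul]
      exact Prod.ext h (pow_smul_cyclic p (by omega) _)
    rw [map_eq_zero_iff _ hg] at h'
    have h₁ : p ^ (m - 1) • (1 : cyclic p m) = 0 := congrArg Prod.fst h'
    rw [smul_one_eq_zero_iff, pow_dvd_pow_iff hp.ne_zero hp.not_isUnit] at h₁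
    omega
  · intro h
    have : Finite (bipicket hp m r).carrier := by
      have := finite_cyclic hp m
      have := finite_cyclic hp r
      exact inferInstanceAs (Finite (cyclic p m × cyclic p r))
    have hsub := ((mem_bipicket_sub_iff hp hr hm).1
      ((map_bipicket_sub_le_iff hp (v := m) (w := r) g).1 f.map_le)).2
    have hz : p ^ r • (g (0, 1)).1 = 0 := by
      have := congrArg Prod.fst (map_one_annihilated (g ∘ₗ LinearMap.inr R _ _))
      exact this
    have hdiag : p ^ (m - 1) • (g (1, 0)).1 = p ^ (r - 1) • cyclicEmb p hrm (g (0, 1)).2 := by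
      rw [Prod.fst_add, Prod.snd_add, Prod.smul_fst, Prod.smul_fst, Prod.smul_snd, Prod.smul_snd,
        smul_add, smul_smul, smul_smul, ← pow_succ', ← pow_succ',
        pow_smul_cyclic p (show r ≤ m - 2 by omega), zero_add, map_smul,
        show r - 1 + 1 = r by omega, hz, add_zero, show m - 2 + 1 = m - 1 by omega] at hsub
      exact hsub
    have hW : p • p ^ (m - 1) • (g (1, 0)).1 = 0 := by
      rw [smul_smul, ← pow_succ', pow_smul_cyclic p (by omega)]
    refine isIso_of_injective f (injective_of_socle _ _
      fun (x : cyclic p m × cyclic p r) hx (hgx : g x = 0) => ?_)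
    change x = 0
    obtain ⟨x, y⟩ := x
    have hx₁ : p • x = 0 := congrArg Prod.fst hx
    have hy₁ : p • y = 0 := congrArg Prod.snd hx
    obtain ⟨a, rfl⟩ := exists_pow_smul_eq hp (show 1 ≤ m by omega) (by rwa [pow_one])
    obtain ⟨b, rfl⟩ := exists_pow_smul_eq hp hr (show p ^ 1 • y = 0 by rwa [pow_one])
    have hsplit : (((a * p ^ (m - 1)) • 1, (b * p ^ (r - 1)) • 1) : cyclic p m × cyclic p r) =
        (a * p ^ (m - 1)) • (1, 0) + (b * p ^ (r - 1)) • (0, 1) := by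
      rw [Prod.smul_mk, Prod.smul_mk, Prod.mk_add_mk, smul_zero, smul_zero, add_zero, zero_add]
    rw [hsplit, map_add, map_smul, map_smul, mul_smul, mul_smul] at hgx
    have hgx₁ : a • p ^ (m - 1) • (g (1, 0)).1 + b • p ^ (r - 1) • (g (0, 1)).1 = 0 :=
      congrArg Prod.fst hgx
    have hgx₂ : a • p ^ (m - 1) • (g (1, 0)).2 + b • p ^ (r - 1) • (g (0, 1)).2 = 0 :=
      congrArg Prod.snd hgx
    rw [pow_smul_cyclic p (by omega), smul_zero, zero_add] at hgx₂
    -- The second coordinate of the kernel equation sees only b; once that term is gone, the first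
    -- coordinate forces p ∣ a.
    have hb : p ∣ b := by
      refine dvd_of_smul_eq_zero hp hW h ?_
      rw [hdiag, ← map_smul, ← map_smul, hgx₂, map_zero]
    obtain ⟨b, rfl⟩ := hb
    have hb₀ : p * b * p ^ (r - 1) = b * p ^ r := by
      rw [mul_right_comm, ← pow_succ', show r - 1 + 1 = r by omega, mul_comm]
    rw [smul_smul (p * b), hb₀, mul_smul b, hz, smul_zero, add_zero] at hgx₁
    obtain ⟨a, rfl⟩ := dvd_of_smul_eq_zero hp hW h hgx₁
    refine Prod.ext ?_ ?_
    · dsimp only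
      rw [mul_right_comm, ← pow_succ', mul_smul, pow_smul_cyclic p (by omega), Prod.fst_zero]
    · dsimp only
      rw [hb₀, mul_smul, pow_smul_cyclic p le_rfl, smul_zero, Prod.snd_zero]

end Isomorphisms

/-! ### Counting endomorphisms and automorphisms -/

section Counts

variable {R : Type u} [CommRing R] [IsDomain R] [IsPrincipalIdealRing R] {p : R}

/-- Regrouping of the matrix entries of an endomorphism of `P^m ⊕ P^r`. -/
theorem card_matrix_entries (hp : Prime p) {m r : ℕ} (hrm : r ≤ m)
    (P : cyclic p m × cyclic p r → Prop) :
    Nat.card {y : (cyclic p m × cyclic p r) × (cyclic p m × cyclic p r) //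
      p ^ r • y.2.1 = 0 ∧ P (y.1.1, y.2.2)} =
      Nat.card (R ⧸ Ideal.span {p}) ^ (r + r) * Nat.card {x // P x} := by
  let e : (cyclic p m × cyclic p r) × (cyclic p m × cyclic p r) ≃
      (cyclic p m × cyclic p r) × (cyclic p m × cyclic p r) :=
    ⟨fun y => ((y.2.1, y.1.2), (y.1.1, y.2.2)), fun y => ((y.2.1, y.1.2), (y.1.1, y.2.2)),
      fun _ => rfl, fun _ => rfl⟩
  have h := card_annihilator_prod hp r r m r
  rw [min_eq_left hrm, min_self] at h
  rw [← h, ← Nat.card_prod]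
  exact Nat.card_congr ((e.subtypeEquiv fun y =>
    and_congr_left' (and_iff_left (pow_smul_cyclic p le_rfl y.1.2)).symm).trans
      (Equiv.subtypeProdEquivProd
        (p := fun x : cyclic p m × cyclic p r => p ^ r • x.1 = 0 ∧ p ^ r • x.2 = 0)))

/-- Off-diagonal entries drop out of the coupling: p^(m-2) kills P^r since r ≤ m - 2, and p^r kills
the entry P^r → P^m. The condition with p^2 holds automatically. -/
theorem endomorphism_condition_iff (hp : Prime p) {m r : ℕ} (hr : 1 ≤ r) (hm : r + 2 ≤ m)
    (y : (cyclic p m × cyclic p r) × (cyclic p m × cyclic p r)) :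
    ((p ^ m • y.1 = 0 ∧ p ^ r • y.2 = 0) ∧
      p ^ (m - 2) • y.1 + p ^ (r - 1) • y.2 ∈ (bipicket hp m r).sub) ↔
    p ^ r • y.2.1 = 0 ∧
      p ^ (m - 1) • y.1.1 = p ^ (r - 1) • cyclicEmb p (show r ≤ m by omega) y.2.2 := by
  obtain ⟨⟨y₁, y₂⟩, z₁, z₂⟩ := y
  have h₁ : p ^ m • (y₁, y₂) = 0 :=
    Prod.ext (pow_smul_cyclic p le_rfl _) (pow_smul_cyclic p (by omega) _)
  have h₂ : p ^ r • (z₁, z₂) = 0 ↔ p ^ r • z₁ = 0 :=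
    Prod.ext_iff.trans (and_iff_left (pow_smul_cyclic p le_rfl z₂))
  rw [and_iff_right h₁, h₂]
  refine and_congr_right fun hz => ?_
  rw [mem_bipicket_sub_iff hp hr hm]
  simp only [Prod.smul_mk, Prod.mk_add_mk]
  rw [pow_smul_cyclic p (show r ≤ m - 2 by omega), zero_add, map_smul, smul_add, smul_add,
    smul_smul, smul_smul, smul_smul, smul_smul, ← pow_add, ← pow_add, ← pow_succ', ← pow_succ',
    show 2 + (m - 2) = m by omega, show m - 2 + 1 = m - 1 by omega, Nat.sub_add_cancel hr, hz,
    add_zero, pow_smul_cyclic p le_rfl, zero_add,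
    pow_smul_eq_zero_of_le (show r ≤ 2 + (r - 1) by omega) hz, and_iff_right rfl]

theorem card_diagonal_entries (hp : Prime p) {m r : ℕ} (hr : 1 ≤ r) (hrm : r ≤ m) :
    Nat.card {x : cyclic p m × cyclic p r // p ^ (m - 1) • x.1 = p ^ (r - 1) • cyclicEmb p hrm x.2} =
      Nat.card (R ⧸ Ideal.span {p}) ^ (m + (r - 1)) := by
  rw [card_cyclicEmb hp hrm fun y z => p ^ (m - 1) • y = p ^ (r - 1) • z]
  have h := card_annihilator_prod hp m (r - 1) m m
  rw [min_self, min_eq_left (show r - 1 ≤ m by omega)] at h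
  rw [← h]
  obtain ⟨r, rfl⟩ := Nat.exists_eq_add_of_le' hr
  obtain ⟨d, rfl⟩ : ∃ d, m = d + r + 1 := ⟨m - (r + 1), by omega⟩
  rw [Nat.add_sub_cancel, Nat.add_sub_cancel]
  -- Here d is m - r in the original notation, and the coupling says p^(r-1) (z - p^(m-r) y) = 0.
  refine card_eq_of_shear (-p ^ d) fun y z => ?_
  dsimp only
  have h₀ : p ^ (d + r + 1) • y = 0 := pow_smul_cyclic p le_rfl y
  constructor
  · rintro ⟨-, h₂⟩
    refine ⟨h₀, ?_⟩
    linear_combination (norm := module) -h₂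
  · rintro ⟨-, h₂⟩
    refine ⟨?_, ?_⟩
    · linear_combination (norm := module) p • h₂ + h₀
    · linear_combination (norm := module) -h₂

/-- Once one side of the coupling vanishes, so does the other, and the entries become independent.
-/
theorem card_nilpotent_diagonal_entries (hp : Prime p) {m r : ℕ} (hrm : r ≤ m) :
    Nat.card {x : cyclic p m × cyclic p r //
      p ^ (m - 1) • x.1 = p ^ (r - 1) • cyclicEmb p hrm x.2 ∧ p ^ (m - 1) • x.1 = 0} =
      Nat.card (R ⧸ Ideal.span {p}) ^ (m - 1 + (r - 1)) := by
  have h := card_annihilator_prod hp (m - 1) (r - 1) m r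
  rw [min_eq_left (Nat.sub_le m 1), min_eq_left (Nat.sub_le r 1)] at h
  rw [← h]
  refine Nat.card_congr (Equiv.subtypeEquivRight fun x => ?_)
  rw [and_comm]
  refine and_congr_right fun h => ?_
  rw [h, eq_comm, ← map_smul, map_eq_zero_iff _ (cyclicEmb_injective hp hrm)]

theorem card_bipicket_end (hp : Prime p) {m r : ℕ} (hr : 1 ≤ r) (hm : r + 2 ≤ m) :
    Nat.card (bipicket hp m r ⟶ bipicket hp m r) =
      Nat.card (R ⧸ Ideal.span {p}) ^ (m + 3 * r - 1) := by
  have hrm : r ≤ m := by omega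
  let e := (bipicketHomEquiv hp m r (bipicket hp m r)).trans
    (Equiv.subtypeEquivRight (endomorphism_condition_iff hp hr hm))
  rw [Nat.card_congr e]
  refine (card_matrix_entries hp hrm fun x : cyclic p m × cyclic p r =>
    p ^ (m - 1) • x.1 = p ^ (r - 1) • cyclicEmb p hrm x.2).trans ?_
  rw [card_diagonal_entries hp hr hrm, ← pow_add]
  congr 1
  omega

theorem card_bipicket_nonaut (hp : Prime p) {m r : ℕ} (hr : 1 ≤ r) (hm : r + 2 ≤ m) :
    Nat.card {f : bipicket hp m r ⟶ bipicket hp m r //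
      p ^ (m - 1) • (bipicketHomEquiv hp m r _ f).1.1.1 = 0} =
      Nat.card (R ⧸ Ideal.span {p}) ^ (m + 3 * r - 2) := by
  have hrm : r ≤ m := by omega
  let D (y : (cyclic p m × cyclic p r) × (cyclic p m × cyclic p r)) : Prop :=
    p ^ (m - 1) • y.1.1 = 0
  let e : {f : bipicket hp m r ⟶ bipicket hp m r //
      p ^ (m - 1) • (bipicketHomEquiv hp m r _ f).1.1.1 = 0} ≃
      {y : (cyclic p m × cyclic p r) × (cyclic p m × cyclic p r) // p ^ r • y.2.1 = 0 ∧
        p ^ (m - 1) • y.1.1 = p ^ (r - 1) • cyclicEmb p hrm y.2.2 ∧ p ^ (m - 1) • y.1.1 = 0} :=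
    (Equiv.subtypeEquiv (q := fun y => D y.1) (bipicketHomEquiv hp m r (bipicket hp m r))
      fun _ => Iff.rfl).trans <|
    (Equiv.subtypeSubtypeEquivSubtypeInter (fun y : (cyclic p m × cyclic p r) ×
      (cyclic p m × cyclic p r) => (p ^ m • y.1 = 0 ∧ p ^ r • y.2 = 0) ∧
        p ^ (m - 2) • y.1 + p ^ (r - 1) • y.2 ∈ (bipicket hp m r).sub) D).trans <| Equiv.subtypeEquivRight fun y =>
      (and_congr_left' (endomorphism_condition_iff hp hr hm y)).trans and_assoc
  rw [Nat.card_congr e]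
  refine (card_matrix_entries hp hrm fun x : cyclic p m × cyclic p r =>
    p ^ (m - 1) • x.1 = p ^ (r - 1) • cyclicEmb p hrm x.2 ∧ p ^ (m - 1) • x.1 = 0).trans ?_
  rw [card_nilpotent_diagonal_entries hp hrm, ← pow_add]
  congr 1
  omega

theorem card_picket_nonaut (hp : Prime p) {ℓ m : ℕ} (hℓ : ℓ ≤ m) :
    Nat.card {f : picket hp ℓ m ⟶ picket hp ℓ m //
      p ^ (m - 1) • (picketHomEquiv hp ℓ m _ f).1 = 0} =
      Nat.card (R ⧸ Ideal.span {p}) ^ (m - 1) := by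
  let D (y : cyclic p m) : Prop := p ^ (m - 1) • y = 0
  let e : {f : picket hp ℓ m ⟶ picket hp ℓ m //
      p ^ (m - 1) • (picketHomEquiv hp ℓ m _ f).1 = 0} ≃
      {y : cyclic p m // p ^ (m - 1) • y = 0} :=
    ((picketHomEquiv hp ℓ m (picket hp ℓ m)).subtypeEquiv
      (q := fun y => D y.1) fun _ => Iff.rfl).trans <|
    (Equiv.subtypeSubtypeEquivSubtypeInter _ D).trans <| Equiv.subtypeEquivRight fun y =>
      -- Every linear endomorphism of P^m preserves the annihilator of p^ℓ, so the subobject imposes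
      -- nothing.
      and_iff_right ⟨pow_smul_cyclic p le_rfl y, (mem_picket_sub_iff hp hℓ).2 <|
        (smul_smul (p ^ ℓ) (p ^ (m - ℓ)) (y : cyclic p m)).trans <| by
          rw [← pow_add]
          exact pow_smul_cyclic p (by omega) y⟩
  rw [Nat.card_congr e, card_annihilator hp, min_eq_left (Nat.sub_le m 1)]

theorem card_aut_of_card_nonaut {C : Type*} [Category* C] {X : C} {D : (X ⟶ X) → Prop} {q n : ℕ}
    (hq : q ≠ 0) (hn : 1 ≤ n) (hX : Nat.card (X ⟶ X) = q ^ n)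
    (hD : Nat.card {f // D f} = q ^ (n - 1)) (h : ∀ f, IsIso f ↔ ¬ D f) :
    (Nat.card (Aut X) : ℚ) = (1 - 1 / (q : ℚ)) * (q : ℚ) ^ n := by
  have : Finite (X ⟶ X) := Nat.finite_of_card_ne_zero (hX ▸ pow_ne_zero n hq)
  have key := card_aut_add_card X h
  rw [hX, hD] at key
  obtain ⟨n, rfl⟩ := Nat.exists_eq_add_of_le' hn
  rw [Nat.add_sub_cancel] at key
  have hq' : (q : ℚ) ≠ 0 := Nat.cast_ne_zero.2 hq
  have key' : (Nat.card (Aut X) : ℚ) + (q : ℚ) ^ n = (q : ℚ) ^ (n + 1) := by exact_mod_cast key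
  rw [eq_sub_of_add_eq key', pow_succ]
  field_simp

end Counts

end PEmbedding

theorem mainTheorem8 {R : Type u} [CommRing R] [IsDomain R] [IsPrincipalIdealRing R]
    {p : R} (hp : Prime p) [Finite (R ⧸ Ideal.span {p})]
    (q : ℕ) (hq : q = Nat.card (R ⧸ Ideal.span {p})) :
    -- (1) endomorphisms and automorphisms of a bipicket
    (∀ m r : ℕ, 1 ≤ r → r + 2 ≤ m →
      Nat.card (End (PEmbedding.bipicket hp m r)) = q ^ (m + 3 * r - 1) ∧
      (Nat.card (Aut (PEmbedding.bipicket hp m r)) : ℚ) =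
        (1 - 1 / (q : ℚ)) * (q : ℚ) ^ (m + 3 * r - 1)) ∧
    -- (2) homomorphisms between pickets, automorphisms of a picket
    (∀ u v ℓ m : ℕ, u ≤ v → ℓ ≤ m →
      Nat.card (PEmbedding.picket hp u v ⟶ PEmbedding.picket hp ℓ m) =
        q ^ min m (v - max 0 (u - ℓ))) ∧
    (∀ ℓ m : ℕ, 1 ≤ m → ℓ ≤ m →
      (Nat.card (Aut (PEmbedding.picket hp ℓ m)) : ℚ) = (1 - 1 / (q : ℚ)) * (q : ℚ) ^ m) ∧
    -- (3) homomorphisms from a bipicket to a picket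
    (∀ v w ℓ m : ℕ, 1 ≤ w → w + 2 ≤ v → ℓ ≤ m →
      Nat.card (PEmbedding.bipicket hp v w ⟶ PEmbedding.picket hp ℓ m) =
        if ℓ = 0 then q ^ (min (v - 1) m + min (w - 1) m)
        else if ℓ = 1 then q ^ (min (v - 1) m + min w m)
        else q ^ (min v m + min w m)) ∧
    -- (4) homomorphisms from a picket to a bipicket
    (∀ u v m r : ℕ, u ≤ v → 1 ≤ r → r + 2 ≤ m →
      Nat.card (PEmbedding.picket hp u v ⟶ PEmbedding.bipicket hp m r) =
        if u = 0 then q ^ (min v r + min v m)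
        else if u = 1 then q ^ (min (v - 1) r + min v m)
        else q ^ (min (v - u + 1) r + min (v - u + 1) m)) := by
  have hspan := (Ideal.span_singleton_prime hp.ne_zero).2 hp
  have hq₀ : q ≠ 0 := hq ▸ Nat.card_pos.ne'
  subst hq
  refine ⟨fun m r hr hm => ⟨PEmbedding.card_bipicket_end hp hr hm, ?_⟩,
    fun u v ℓ m hu hℓ => PEmbedding.card_picket_hom_picket hp hu hℓ, fun ℓ m hm hℓ => ?_,
    fun v w ℓ m hw hv hℓ => PEmbedding.card_bipicket_hom_picket hp hw hv hℓ,
    fun u v m r hu hr hm => PEmbedding.card_picket_hom_bipicket hp hu hr hm⟩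
  · exact PEmbedding.card_aut_of_card_nonaut hq₀ (by omega)
      (PEmbedding.card_bipicket_end hp hr hm)
      (PEmbedding.card_bipicket_nonaut hp hr hm) (PEmbedding.isIso_bipicket_iff hp hr hm)
  · refine PEmbedding.card_aut_of_card_nonaut hq₀ hm ?_
      (PEmbedding.card_picket_nonaut hp hℓ) (PEmbedding.isIso_picket_iff hp hm)
    rw [PEmbedding.card_picket_hom_picket hp hℓ hℓ]
    congr 1
    omega
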